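/- **Theorem 3 (Adaptive pruning equals extensive sweeping).** *Setting.* Let $\Omega\subset\mathbb R^2$ be a bounded convex open set, $X:=\Omega\cap\mathbb Z^2$, and let $u:X\cup\partial\Omega\to\mathbb R$ be a discrete map. For $x\in X$ and $e\in\mathbb Z^2$ with coprime coordinates, let $h^\pm$ be the only element of $]0,1]$ such that $x\pm h^\pm e\in X\cup\partial\Omega$, and set $$\Delta_e u(x):=\frac{2}{h^++h^-}\left(\frac{u(x+h^+e)-u(x)}{h^+}+\frac{u(x-h^-e)-u(x)}{h^-}\right),\qquad \Delta_e^+u(x):=\max\{0,\Delta_eu(x)\},$$ so that $\Delta_eu(x)=u(x+e)-2u(x)+u(x-e)$ if $x\pm e\in\Omega$ (that is, $x+e\in\Omega$ and $x-e\in\Omega$). For $a,b,c\ge 0$ let $h(a,b,c):=bc$ if $a\ge b+c$, and likewise permuting $a,b,c$, and $h(a,b,c):=\frac12(ab+bc+ca)-\frac14(a^2+b^2+c^2)$ otherwise. A superbase of $\mathbb Z^2$ is a triplet $(e,f,g)\in(\mathbb Z^2)^3$ with $e+f+g=0$ and $|\det(f,g)|=1$. *Stencils.* Write $e=f\oplus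 g$ if $e=f+g$ with $f,g\in\mathbb Z^2$, $\det(f,g)=1$ and $\langle f,g\rangle\ge0$. Let $\mathbb T$ be the graph with vertices $\{e\in\mathbb Z^2:\gcd(e)=1\}$ and edges $e\to f\oplus e$ and $e\to e\oplus g$ for each $e=f\oplus g$; any subset of $\mathbb T$ is regarded as a subgraph, with all edges of $\mathbb T$ having both endpoints in it. Let $V_8:=\{-1,0,1\}^2\setminus\{(0,0)\}$, and for $x\in X$ let $$\mathcal V_\Omega(x):=\{e=f\oplus g:\ x\pm e,\ x\pm f,\ x\pm g\in\Omega\}.$$ A family of stencils $\mathcal V$ is the data, for each $x\in X$, of a finite set $\mathcal V(x)\subset\mathbb Z^2\setminus\{0\}$, symmetric with respect to the origin, with $V_8\subset\mathcal V(x)\subset\mathbb T$, such that * (Hierarchy) $V_8$ has an element in each connected component of $\mathcal V(x)$; * (Reachability) $\mathcal V(x)$ contains each $e\in\mathbb T\setminus\mathcal V_\Omega(x)$ such that $x\pm e\in\Omega$. The extended stencils are $\overline{\mathcal V}(x):=\mathcal V(x)\cup\mathcal V_\Omega(x)$. *Operators.* The MA-LBR operator on the extended stencils is $$\mathcal D_{\overline{\mathcal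 V}}u(x):=\min\{h(\Delta_e^+u(x),\Delta_f^+u(x),\Delta_g^+u(x)):\ (e,f,g)\in\overline{\mathcal V}(x)^3\text{ is a superbase}\}.$$ The adaptive operator $\overline{\mathcal D}_{\mathcal V}u(x)$ is the final value of $\mathbb D$ in the following algorithm. Initialize $f\leftarrow(1,0)$, the list $G\leftarrow[(0,1),(-1,0)]$, and $\mathbb D\leftarrow+\infty$. While $G$ is non-empty: let $g$ be the first element of $G$ and $e:=f+g$; if $e\in\mathcal V(x)$, or [$e\in\mathcal V_\Omega(x)$ and $\Delta_eu(x)<\Delta_fu(x)+\Delta_gu(x)$], then prepend $e$ to $G$ and set $\mathbb D\leftarrow\min\{\mathbb D,h(\Delta_e^+u(x),\Delta_f^+u(x),\Delta_g^+u(x))\}$; otherwise remove $g$ from $G$ and set $f\leftarrow g$. *Statement.* Let $\mathcal V$ be a family of stencils and $u:X\cup\partial\Omega\to\mathbb R$. Then both operators are well defined and real-valued (for every $x\in X$ the algorithm terminates with a finite $\mathbb D$ and the minimum is attained), and $\mathcal D_{\overline{\mathcal V}}u\le\overline{\mathcal D}_{\mathcal V}u$ on $X$. If moreover $\overline{\mathcal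 D}_{\mathcal V}u>0$ at every point of $X$, or $\mathcal D_{\overline{\mathcal V}}u>0$ at every point of $X$, then $\overline{\mathcal D}_{\mathcal V}u=\mathcal D_{\overline{\mathcal V}}u$ at every point of $X$. -/

import Mathlib

namespace MALBR

/-! ## Arithmetic of the lattice: superbases, the Stern-Brocot graph -/

/-- Determinant of a pair of integer vectors. -/
def det (f g : ℤ × ℤ) : ℤ := f.1 * g.2 - f.2 * g.1

/-- Euclidean scalar product of a pair of integer vectors. -/
def dot (f g : ℤ × ℤ) : ℤ := f.1 * g.1 + f.2 * g.2

/-- `(f, g)` is a basis of `ℤ²`. -/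
def IsBasis (f g : ℤ × ℤ) : Prop := |det f g| = 1

/-- `(e, f, g)` is a superbase of `ℤ²`. -/
def IsSuperbase (e f g : ℤ × ℤ) : Prop := e + f + g = 0 ∧ IsBasis f g

/-- `e = f ⊕ g`: the vector `e` is the sum of the direct acute basis `(f, g)` of `ℤ²`.
(Such an `e` automatically has coprime, non-zero coordinates.) -/
def IsDecomp (e f g : ℤ × ℤ) : Prop := e = f + g ∧ det f g = 1 ∧ 0 ≤ dot f g

/-- The vertices of the graph `𝕋`: integer vectors with coprime coordinates. -/
def primitiveVectors : Set (ℤ × ℤ) := {e | Int.gcd e.1 e.2 = 1}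

/-- The directed edges of the graph `𝕋`: `e → f ⊕ e` and `e → e ⊕ g` whenever `e = f ⊕ g`. -/
def TreeEdge (e e' : ℤ × ℤ) : Prop :=
  ∃ f g, IsDecomp e f g ∧ (e' = f + e ∨ e' = e + g)

/-- The undirected graph underlying `𝕋`, used for connected components. Its edges only join
primitive vectors (every other element of `ℤ × ℤ` is isolated). -/
def treeGraph : SimpleGraph (ℤ × ℤ) := SimpleGraph.fromRel TreeEdge

/-- The eight point stencil. -/
def V8 : Set (ℤ × ℤ) :=
  {e | e.1 ∈ ({-1, 0, 1} : Set ℤ) ∧ e.2 ∈ ({-1, 0, 1} : Set ℤ) ∧ e ≠ 0}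

/-! ## The discrete domain, discrete maps and second order differences -/

/-- The embedding of `ℤ²` in the plane. -/
def toPlane (z : ℤ × ℤ) : ℝ × ℝ := ((z.1 : ℝ), (z.2 : ℝ))

/-- The discrete domain `X = Ω ∩ ℤ²`. -/
def grid (Ω : Set (ℝ × ℝ)) : Set (ℤ × ℤ) := {z | toPlane z ∈ Ω}

/-- The set `X ∪ ∂Ω`, as a subset of the plane. -/
def nodes (Ω : Set (ℝ × ℝ)) : Set (ℝ × ℝ) := toPlane '' grid Ω ∪ frontier Ω

/-- The discrete maps `u : X ∪ ∂Ω → ℝ`. -/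
abbrev DiscreteMap (Ω : Set (ℝ × ℝ)) : Type := nodes Ω → ℝ

open Classical in
/-- The value of a discrete map at a point of the plane; it is only used at points
of `X ∪ ∂Ω` (the value elsewhere is a dummy). -/
noncomputable def DiscreteMap.val {Ω : Set (ℝ × ℝ)} (u : DiscreteMap Ω) (p : ℝ × ℝ) : ℝ :=
  if hp : p ∈ nodes Ω then u ⟨p, hp⟩ else 0

/-- The only element `t` of `]0,1]` such that `x + t e ∈ X ∪ ∂Ω`. (It exists and is unique when
`Ω` is bounded, convex and open, `x ∈ X`, and `e` is primitive; the set below is then a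
singleton, and the infimum is its element.) -/
noncomputable def reach (Ω : Set (ℝ × ℝ)) (x e : ℤ × ℤ) : ℝ :=
  sInf {t : ℝ | 0 < t ∧ t ≤ 1 ∧ toPlane x + t • toPlane e ∈ nodes Ω}

open Classical in
/-- The second order difference `Δ_e u(x)`. -/
noncomputable def secondDiff {Ω : Set (ℝ × ℝ)} (u : DiscreteMap Ω) (x e : ℤ × ℤ) : ℝ :=
  if x + e ∈ grid Ω ∧ x - e ∈ grid Ω then
    u.val (toPlane (x + e)) - 2 * u.val (toPlane x) + u.val (toPlane (x - e))
  else
    2 / (reach Ω x e + reach Ω x (-e)) *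
      ((u.val (toPlane x + reach Ω x e • toPlane e) - u.val (toPlane x)) / reach Ω x e
        + (u.val (toPlane x - reach Ω x (-e) • toPlane e) - u.val (toPlane x))
            / reach Ω x (-e))

/-- The positive part `Δ⁺_e u(x) = max {0, Δ_e u(x)}`. -/
noncomputable def secondDiffPos {Ω : Set (ℝ × ℝ)} (u : DiscreteMap Ω) (x e : ℤ × ℤ) : ℝ :=
  max 0 (secondDiff u x e)

/-- The function `h` on `ℝ₊³`: `h(a,b,c) = bc` if `a ≥ b + c`, likewise permuting `a, b, c`, and
`(ab + bc + ca)/2 - (a² + b² + c²)/4` otherwise. -/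
noncomputable def hFun (a b c : ℝ) : ℝ :=
  if b + c ≤ a then b * c
  else if c + a ≤ b then c * a
  else if a + b ≤ c then a * b
  else 1 / 2 * (a * b + b * c + c * a) - 1 / 4 * (a ^ 2 + b ^ 2 + c ^ 2)

/-- The number `h(Δ⁺_e u(x), Δ⁺_f u(x), Δ⁺_g u(x))`. -/
noncomputable def hDiff {Ω : Set (ℝ × ℝ)} (u : DiscreteMap Ω) (x e f g : ℤ × ℤ) : ℝ :=
  hFun (secondDiffPos u x e) (secondDiffPos u x f) (secondDiffPos u x g)

/-! ## Stencils -/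

/-- A stencil: a finite subset of `ℤ² \ {0}`, symmetric with respect to the origin. -/
def IsStencil (V : Set (ℤ × ℤ)) : Prop :=
  V.Finite ∧ (0 : ℤ × ℤ) ∉ V ∧ ∀ e ∈ V, -e ∈ V

/-- The set `𝒱_Ω(x)` of all `e = f ⊕ g` such that `x ± e, x ± f, x ± g ∈ Ω`. -/
def innerVectors (Ω : Set (ℝ × ℝ)) (x : ℤ × ℤ) : Set (ℤ × ℤ) :=
  {e | ∃ f g, IsDecomp e f g ∧
    (x + e ∈ grid Ω ∧ x - e ∈ grid Ω) ∧
    (x + f ∈ grid Ω ∧ x - f ∈ grid Ω) ∧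
    (x + g ∈ grid Ω ∧ x - g ∈ grid Ω)}

/-- (Hierarchy): `V₈` has an element in each connected component of `V`, regarded as an induced
subgraph of `𝕋`. -/
def Hierarchy (V : Set (ℤ × ℤ)) : Prop :=
  ∀ c : (treeGraph.induce V).ConnectedComponent,
    ∃ v : V, (v : ℤ × ℤ) ∈ V8 ∧ (treeGraph.induce V).connectedComponentMk v = c

/-- (Reachability) at the point `x`: `V` contains each `e ∈ 𝕋 \ 𝒱_Ω(x)` with `x ± e ∈ Ω`. -/
def Reachability (Ω : Set (ℝ × ℝ)) (x : ℤ × ℤ) (V : Set (ℤ × ℤ)) : Prop :=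
  ∀ e ∈ primitiveVectors \ innerVectors Ω x, x + e ∈ grid Ω → x - e ∈ grid Ω → e ∈ V

/-- A family of stencils on the discrete domain `X = Ω ∩ ℤ²`. -/
structure IsStencilFamily (Ω : Set (ℝ × ℝ)) (V : grid Ω → Set (ℤ × ℤ)) : Prop where
  isStencil : ∀ x : grid Ω, IsStencil (V x)
  v8_subset : ∀ x : grid Ω, V8 ⊆ V x
  subset_primitive : ∀ x : grid Ω, V x ⊆ primitiveVectors
  hierarchy : ∀ x : grid Ω, Hierarchy (V x)
  reachability : ∀ x : grid Ω, Reachability Ω x (V x)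

/-- The extended stencils `𝒱̄(x) = 𝒱(x) ∪ 𝒱_Ω(x)`. -/
def extend {Ω : Set (ℝ × ℝ)} (V : grid Ω → Set (ℤ × ℤ)) : grid Ω → Set (ℤ × ℤ) :=
  fun x => V x ∪ innerVectors Ω x

/-! ## The two operators -/

/-- `D` is the MA-LBR operator of the family `V` applied to `u`: for each `x ∈ X`, the number
`D x` is the minimum of `h(Δ⁺_e u(x), Δ⁺_f u(x), Δ⁺_g u(x))` over all superbases
`(e, f, g) ∈ V(x)³`. -/
def IsLBROperator {Ω : Set (ℝ × ℝ)} (V : grid Ω → Set (ℤ × ℤ)) (u : DiscreteMap Ω)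
    (D : grid Ω → ℝ) : Prop :=
  ∀ x : grid Ω, IsLeast
    {r : ℝ | ∃ e ∈ V x, ∃ f ∈ V x, ∃ g ∈ V x, IsSuperbase e f g ∧ r = hDiff u x e f g} (D x)

/-- The variables of the adaptive algorithm: a vector `f`, a list `G` of vectors, and the
current minimum `best`, which lies in `ℝ ∪ {+∞}`. -/
structure State where
  f : ℤ × ℤ
  G : List (ℤ × ℤ)
  best : WithTop ℝ

/-- Initialization: `f ← (1,0)`, `G ← [(0,1), (-1,0)]`, `best ← +∞`. -/
noncomputable def initState : State := ⟨(1, 0), [(0, 1), (-1, 0)], ⊤⟩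

/-- The refinement test for `e = f + g`: either `e ∈ V(x)`, or `e ∈ 𝒱_Ω(x)` and
`Δ_e u(x) < Δ_f u(x) + Δ_g u(x)`. -/
def RefinementTest {Ω : Set (ℝ × ℝ)} (V : grid Ω → Set (ℤ × ℤ)) (u : DiscreteMap Ω)
    (x : grid Ω) (f g : ℤ × ℤ) : Prop :=
  f + g ∈ V x ∨
    (f + g ∈ innerVectors Ω x ∧ secondDiff u x (f + g) < secondDiff u x f + secondDiff u x g)

open Classical in
/-- One iteration of the `While` loop (nothing happens once the list `G` is empty). -/
noncomputable def step {Ω : Set (ℝ × ℝ)} (V : grid Ω → Set (ℤ × ℤ)) (u : DiscreteMap Ω)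
    (x : grid Ω) (s : State) : State :=
  match s.G with
  | [] => s
  | g :: G' =>
    if RefinementTest V u x s.f g then
      ⟨s.f, (s.f + g) :: g :: G', min s.best ((hDiff u x (s.f + g) s.f g : ℝ) : WithTop ℝ)⟩
    else
      ⟨g, G', s.best⟩

/-- The algorithm at the point `x` terminates, and the final value of the current minimum is the
real number `d`. (At most one `d` has this property.) -/
def Returns {Ω : Set (ℝ × ℝ)} (V : grid Ω → Set (ℤ × ℤ)) (u : DiscreteMap Ω)
    (x : grid Ω) (d : ℝ) : Prop :=
  ∃ n : ℕ, ((step V u x)^[n] initState).G = [] ∧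
    ((step V u x)^[n] initState).best = (d : WithTop ℝ)

/-- `D` is the adaptive (hierarchical) operator of the family `V` applied to `u`: for each
`x ∈ X`, the algorithm at `x` terminates and returns `D x`. -/
def IsAdaptiveOperator {Ω : Set (ℝ × ℝ)} (V : grid Ω → Set (ℤ × ℤ)) (u : DiscreteMap Ω)
    (D : grid Ω → ℝ) : Prop :=
  ∀ x : grid Ω, Returns V u x (D x)

end MALBR

namespace MALBR

/-! ## The function `h` -/

/-! Every superbase has, up to order and signs, the form (-(f + g), f, g) with (f, g) direct and
acute, and h is unaffected by these changes. Acute bases descend from orthonormal ones by (f, g) →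
(f, f + g) or (f + g, g). The algorithm explores this tree up to a global sign, cutting a branch
when the refinement test fails. It thus returns the minimum over the accepted bases
(`exists_returns`), whose superbases lie in the extended stencil; hence the inequality, and
positivity of the extended operator implies that of the adaptive one.

For equality, the pruned bases must be harmless. Where Δ_{f+g} ≥ Δ_f + Δ_g with Δ_f, Δ_g ≥ 0, h
equals Δ_f Δ_g, which bounds h from above on any superbase containing ±f and ±g, in particular on
the parent of (f, g) (`hDiff_le_hDiff_of_add_le`). Moving up the tree therefore does not increase
the value, until an accepted basis is met.

This requires that a basis below a pruned one satisfy the same inequality, which follows from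
convexity of u at neighbouring points in shorter directions (`secondDiff_add_le_of_convex`,
`accepted_or_pruned`). Convexity is itself obtained from positivity, by induction on the length of
the direction at all grid points simultaneously (`convexUpTo_of_pos`): an accepted basis has
positive differences, and for a pruned one Δ_{f+g} ≥ Δ_f + Δ_g ≥ 0. -/

theorem hFun_swap {a b c : ℝ} (ha : 0 ≤ a) : hFun a b c = hFun a c b := by
  unfold hFun
  -- The cases c + a ≤ b and a + b ≤ c overlap only when a = 0, where both products vanish.
  split_ifs <;> first
    | ring1
    | (exfalso; linarith)
    | (obtain rfl : a = 0 := by linarith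
       ring1)

theorem hFun_rotate {a b c : ℝ} (hb : 0 ≤ b) (hc : 0 ≤ c) :
    hFun a b c = hFun b c a := by
  unfold hFun
  split_ifs <;> first
    | ring1
    | (obtain rfl : b = 0 := by linarith
       ring1)
    | (obtain rfl : c = 0 := by linarith
       ring1)

theorem hFun_le_mul {a b c : ℝ} (hb : 0 ≤ b) (hc : 0 ≤ c) :
    hFun a b c ≤ b * c := by
  unfold hFun
  split_ifs
  · exact le_rfl
  · nlinarith
  · nlinarith
  -- Here bc - h(a, b, c) = (b + c - a)² / 4.
  · nlinarith [sq_nonneg (b + c - a)]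

theorem hFun_of_add_le {a b c : ℝ} (h : b + c ≤ a) : hFun a b c = b * c := by
  simp [hFun, h]

theorem pos_of_hFun_pos {a b c : ℝ} (ha : 0 ≤ a) (hb : 0 ≤ b) (hc : 0 ≤ c)
    (h : 0 < hFun a b c) : 0 < a ∧ 0 < b ∧ 0 < c := by
  have h1 : 0 < b * c := h.trans_le (hFun_le_mul hb hc)
  have h2 : 0 < c * a := by
    rw [hFun_rotate hb hc] at h
    exact h.trans_le (hFun_le_mul hc ha)
  refine ⟨ha.lt_of_ne ?_, hb.lt_of_ne ?_, hc.lt_of_ne ?_⟩ <;> rintro rfl <;> simp at h1 h2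

/-! ## Second order differences -/

section secondDiff

variable {Ω : Set (ℝ × ℝ)} (u : DiscreteMap Ω) (x : ℤ × ℤ)

theorem toPlane_neg (e : ℤ × ℤ) : toPlane (-e) = -toPlane e := by
  simp [toPlane]

theorem secondDiff_neg (e : ℤ × ℤ) : secondDiff u x (-e) = secondDiff u x e := by
  have hiff : (x + -e ∈ grid Ω ∧ x - -e ∈ grid Ω) ↔ (x + e ∈ grid Ω ∧ x - e ∈ grid Ω) := by
    rw [← sub_eq_add_neg, sub_neg_eq_add, and_comm]
  unfold secondDiff
  by_cases h : x + e ∈ grid Ω ∧ x - e ∈ grid Ω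
  · rw [if_pos h, if_pos (hiff.2 h), ← sub_eq_add_neg, sub_neg_eq_add]
    ring
  · rw [if_neg h, if_neg (hiff.not.2 h), neg_neg, toPlane_neg, smul_neg, smul_neg,
      ← sub_eq_add_neg, sub_neg_eq_add, add_comm (reach Ω x (-e))]
    congr 1
    rw [add_comm]

theorem secondDiffPos_neg (e : ℤ × ℤ) : secondDiffPos u x (-e) = secondDiffPos u x e := by
  rw [secondDiffPos, secondDiff_neg, secondDiffPos]

theorem secondDiffPos_nonneg (e : ℤ × ℤ) : 0 ≤ secondDiffPos u x e := le_max_left _ _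

theorem secondDiffPos_of_nonneg {e : ℤ × ℤ} (h : 0 ≤ secondDiff u x e) :
    secondDiffPos u x e = secondDiff u x e := max_eq_right h

theorem secondDiff_pos_of_secondDiffPos_pos {e : ℤ × ℤ} (h : 0 < secondDiffPos u x e) :
    0 < secondDiff u x e := by
  simpa [secondDiffPos] using h

theorem hDiff_swap (e f g : ℤ × ℤ) : hDiff u x e f g = hDiff u x e g f :=
  hFun_swap (secondDiffPos_nonneg ..)

theorem hDiff_rotate (e f g : ℤ × ℤ) : hDiff u x e f g = hDiff u x f g e :=
  hFun_rotate (secondDiffPos_nonneg ..) (secondDiffPos_nonneg ..)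

theorem hDiff_neg_left (e f g : ℤ × ℤ) : hDiff u x (-e) f g = hDiff u x e f g := by
  simp only [hDiff, secondDiffPos_neg]

theorem hDiff_neg (e f g : ℤ × ℤ) : hDiff u x (-e) (-f) (-g) = hDiff u x e f g := by
  simp only [hDiff, secondDiffPos_neg]

theorem secondDiff_pos_of_hDiff_pos {e f g : ℤ × ℤ} (h : 0 < hDiff u x e f g) :
    0 < secondDiff u x e ∧ 0 < secondDiff u x f ∧ 0 < secondDiff u x g := by
  obtain ⟨h1, h2, h3⟩ := pos_of_hFun_pos (secondDiffPos_nonneg ..) (secondDiffPos_nonneg ..)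
    (secondDiffPos_nonneg ..) h
  exact ⟨secondDiff_pos_of_secondDiffPos_pos u x h1, secondDiff_pos_of_secondDiffPos_pos u x h2,
    secondDiff_pos_of_secondDiffPos_pos u x h3⟩

/-- The right side is exactly Δ_f Δ_g, an upper bound for h whatever its first argument. Used with k
the difference of f and g, it compares a pruned basis with its parent. -/
theorem hDiff_le_hDiff_of_add_le {e f g k : ℤ × ℤ} (hf : 0 ≤ secondDiff u x f)
    (hg : 0 ≤ secondDiff u x g) (h : secondDiff u x f + secondDiff u x g ≤ secondDiff u x e) :
    hDiff u x k f g ≤ hDiff u x e f g := by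
  have he : hDiff u x e f g = secondDiffPos u x f * secondDiffPos u x g := by
    refine hFun_of_add_le ?_
    rw [secondDiffPos_of_nonneg u x hf, secondDiffPos_of_nonneg u x hg,
      secondDiffPos_of_nonneg u x ((add_nonneg hf hg).trans h)]
    exact h
  rw [he]
  exact hFun_le_mul (secondDiffPos_nonneg ..) (secondDiffPos_nonneg ..)

theorem secondDiff_of_mem {e : ℤ × ℤ} (h1 : x + e ∈ grid Ω) (h2 : x - e ∈ grid Ω) :
    secondDiff u x e =
      u.val (toPlane (x + e)) - 2 * u.val (toPlane x) + u.val (toPlane (x - e)) := by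
  rw [secondDiff, if_pos ⟨h1, h2⟩]

/-- The inequality `Δ_k + Δ_g ≤ Δ_p`, where `p = k + g`, propagates to `Δ_p + Δ_g ≤ Δ_{p + g}`
when `u` is convex in the direction `g` at the points `x ± p`. -/
theorem secondDiff_add_le_of_convex {k g p : ℤ × ℤ} (hp : p = k + g)
    (hk : x + k ∈ grid Ω ∧ x - k ∈ grid Ω) (hg : x + g ∈ grid Ω ∧ x - g ∈ grid Ω)
    (hpm : x + p ∈ grid Ω ∧ x - p ∈ grid Ω)
    (hpg : x + (p + g) ∈ grid Ω ∧ x - (p + g) ∈ grid Ω)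
    (h : secondDiff u x k + secondDiff u x g ≤ secondDiff u x p)
    (h1 : 0 ≤ secondDiff u (x + p) g) (h2 : 0 ≤ secondDiff u (x - p) g) :
    secondDiff u x p + secondDiff u x g ≤ secondDiff u x (p + g) := by
  have e1 : x + p + g = x + (p + g) := by abel
  have e2 : x + p - g = x + k := by rw [hp]; abel
  have e3 : x - p + g = x - k := by rw [hp]; abel
  have e4 : x - p - g = x - (p + g) := by abel
  rw [secondDiff_of_mem u _ (e1 ▸ hpg.1) (e2 ▸ hk.1), e1, e2] at h1
  rw [secondDiff_of_mem u _ (e3 ▸ hk.2) (e4 ▸ hpg.2), e3, e4] at h2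
  rw [secondDiff_of_mem u _ hk.1 hk.2, secondDiff_of_mem u _ hg.1 hg.2,
    secondDiff_of_mem u _ hpm.1 hpm.2] at h
  rw [secondDiff_of_mem u _ hpm.1 hpm.2, secondDiff_of_mem u _ hg.1 hg.2,
    secondDiff_of_mem u _ hpg.1 hpg.2]
  -- Δ_g u(x + p) + Δ_g u(x - p) = Δ_{p+g} u(x) - 2 Δ_p u(x) + Δ_k u(x).
  linarith

end secondDiff

/-! ## Bases of `ℤ²` and the Stern-Brocot graph -/

theorem dot_add_self (f g : ℤ × ℤ) : dot (f + g) (f + g) = dot f f + 2 * dot f g + dot g g := by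
  simp [dot]; ring

theorem det_sq_add_dot_sq (f g : ℤ × ℤ) : det f g ^ 2 + dot f g ^ 2 = dot f f * dot g g := by
  simp [dot, det]; ring

theorem dot_self_nonneg (f : ℤ × ℤ) : 0 ≤ dot f f := by
  simp only [dot]; nlinarith [mul_self_nonneg f.1, mul_self_nonneg f.2]

theorem dot_self_pos_of_det {f g : ℤ × ℤ} (h : det f g = 1) : 0 < dot f f ∧ 0 < dot g g := by
  have h1 := det_sq_add_dot_sq f g
  rw [h] at h1
  have hf := dot_self_nonneg f
  have hg := dot_self_nonneg g
  constructor <;> refine lt_of_le_of_ne ?_ ?_ <;> first | assumption | skip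
  · intro h0; rw [← h0] at h1; nlinarith [sq_nonneg (dot f g)]
  · intro h0; rw [← h0] at h1; nlinarith [sq_nonneg (dot f g)]

theorem IsDecomp.dot_self_lt {e f g : ℤ × ℤ} (h : IsDecomp e f g) :
    dot f f < dot e e ∧ dot g g < dot e e := by
  obtain ⟨rfl, h1, h2⟩ := h
  have := dot_self_pos_of_det h1
  rw [dot_add_self]
  constructor <;> linarith

theorem IsDecomp.neg {e f g : ℤ × ℤ} (h : IsDecomp e f g) : IsDecomp (-e) (-f) (-g) := by
  obtain ⟨rfl, h1, h2⟩ := h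
  refine ⟨by abel, ?_, ?_⟩
  · simpa [det] using h1
  · simpa [dot] using h2

theorem IsDecomp.left {e f g : ℤ × ℤ} (h : IsDecomp e f g) : IsDecomp (f + e) f e := by
  obtain ⟨rfl, h1, h2⟩ := h
  refine ⟨rfl, ?_, ?_⟩
  · rw [← h1]; simp only [det, Prod.fst_add, Prod.snd_add]; ring
  · have : dot f (f + g) = dot f f + dot f g := by simp [dot]; ring
    rw [this]; linarith [dot_self_nonneg f]

theorem IsDecomp.right {e f g : ℤ × ℤ} (h : IsDecomp e f g) : IsDecomp (e + g) e g := by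
  obtain ⟨rfl, h1, h2⟩ := h
  refine ⟨rfl, ?_, ?_⟩
  · rw [← h1]; simp only [det, Prod.fst_add, Prod.snd_add]; ring
  · have : dot (f + g) g = dot f g + dot g g := by simp [dot]; ring
    rw [this]; linarith [dot_self_nonneg g]

/-- Since det(f, e) = det(f', e) = 1, f' - f is an integer multiple of e. Acuteness puts ⟨f, e⟩ and
⟨f', e⟩ strictly between 0 and ⟨e, e⟩, so the multiple is zero. -/
theorem IsDecomp.unique {e f g f' g' : ℤ × ℤ} (h : IsDecomp e f g) (h' : IsDecomp e f' g') :
    f = f' ∧ g = g' := by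
  obtain ⟨he, hd, ht⟩ := h
  obtain ⟨he', hd', ht'⟩ := h'
  obtain ⟨hf, hg⟩ := dot_self_pos_of_det hd
  obtain ⟨hf', hg'⟩ := dot_self_pos_of_det hd'
  have b1 : dot f e = dot f f + dot f g := by subst he; simp [dot]; ring
  have b2 : dot f' e = dot f' f' + dot f' g' := by subst he'; simp [dot]; ring
  have c1 : dot e e = dot f f + 2 * dot f g + dot g g := by rw [he, dot_add_self]
  have c2 : dot e e = dot f' f' + 2 * dot f' g' + dot g' g' := by rw [he', dot_add_self]
  have d1 : det f e = 1 := by rw [← hd, he]; simp only [det, Prod.fst_add, Prod.snd_add]; ring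
  have d2 : det f' e = 1 := by rw [← hd', he']; simp only [det, Prod.fst_add, Prod.snd_add]; ring
  have k1 : f'.1 = f.1 + det f f' * e.1 := by
    simp only [det] at d1 d2 ⊢
    linear_combination (-f'.1) * d1 + f.1 * d2
  have k2 : f'.2 = f.2 + det f f' * e.2 := by
    simp only [det] at d1 d2 ⊢
    linear_combination (-f'.2) * d1 + f.2 * d2
  have k3 : dot f' e = dot f e + det f f' * dot e e := by
    simp only [dot]
    linear_combination e.1 * k1 + e.2 * k2
  have k4 : det f f' = 0 := by
    by_contra hne
    rcases lt_or_gt_of_ne hne with hlt | hlt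
    · have : det f f' * dot e e ≤ -1 * dot e e :=
        mul_le_mul_of_nonneg_right (by omega) (dot_self_nonneg e)
      linarith
    · have : 1 * dot e e ≤ det f f' * dot e e :=
        mul_le_mul_of_nonneg_right (by omega) (dot_self_nonneg e)
      linarith
  rw [k4] at k1 k2
  have : f = f' := Prod.ext (by linarith) (by linarith)
  refine ⟨this, ?_⟩
  subst this
  exact add_left_cancel (he.symm.trans he')

/-- A direct acute basis either consists of unit vectors, or comes from a shorter one. -/
theorem IsDecomp.cases_parent {e f g : ℤ × ℤ} (h : IsDecomp e f g) :
    dot f g = 0 ∨ IsDecomp f (f - g) g ∨ IsDecomp g f (g - f) := by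
  obtain ⟨rfl, hd, ht⟩ := h
  obtain ⟨hf, hg⟩ := dot_self_pos_of_det hd
  rcases ht.eq_or_lt with h0 | hpos
  · exact Or.inl h0.symm
  right
  have hsq := det_sq_add_dot_sq f g
  rw [hd] at hsq
  by_cases hle : dot g g ≤ dot f g
  · left
    refine ⟨by abel, ?_, ?_⟩
    · rw [← hd]; simp only [det, Prod.fst_sub, Prod.snd_sub]; ring
    · have : dot (f - g) g = dot f g - dot g g := by simp [dot]; ring
      rw [this]; linarith
  · right
    -- Otherwise both squared norms are at least ⟨f, g⟩ + 1, and their product exceeds 1 + ⟨f, g⟩².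
    have hle' : dot f f ≤ dot f g := by
      by_contra hcon
      push Not at hle hcon
      have : (dot f g + 1) * (dot f g + 1) ≤ dot f f * dot g g :=
        mul_le_mul (by omega) (by omega) (by omega) (by omega)
      nlinarith
    refine ⟨by abel, ?_, ?_⟩
    · rw [← hd]; simp only [det, Prod.fst_sub, Prod.snd_sub]; ring
    · have : dot f (g - f) = dot f g - dot f f := by simp [dot]; ring
      rw [this]; linarith

theorem mem_primitiveVectors_of_det {f g : ℤ × ℤ} (h : det f g = 1) :
    f ∈ primitiveVectors ∧ g ∈ primitiveVectors := by
  simp only [primitiveVectors, Set.mem_ofPred_eq, ← Int.isCoprime_iff_gcd_eq_one]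
  simp only [det] at h
  exact ⟨⟨g.2, -g.1, by linarith⟩, ⟨-f.2, f.1, by linarith⟩⟩

theorem mem_V8_of_dot_self_le {e : ℤ × ℤ} (h0 : 0 < dot e e) (h : dot e e ≤ 2) : e ∈ V8 := by
  obtain ⟨a, b⟩ := e
  simp only [dot] at h0 h
  have ha : -1 ≤ a ∧ a ≤ 1 := by constructor <;> nlinarith [mul_self_nonneg b]
  have hb : -1 ≤ b ∧ b ≤ 1 := by constructor <;> nlinarith [mul_self_nonneg a]
  refine ⟨?_, ?_, ?_⟩
  · simp; omega
  · simp; omega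
  · intro hab
    simp only [Prod.mk_eq_zero] at hab
    simp [hab.1, hab.2] at h0

theorem V8_dot_self {e : ℤ × ℤ} (h : e ∈ V8) : dot e e = 1 ∨ dot e e = 2 := by
  obtain ⟨a, b⟩ := e
  obtain ⟨h1, h2, h3⟩ := h
  simp only [Set.mem_insert_iff, Set.mem_singleton_iff] at h1 h2
  rcases h1 with rfl | rfl | rfl <;> rcases h2 with rfl | rfl | rfl <;> simp [dot] at h3 ⊢

theorem V8_unit_or_decomp {e : ℤ × ℤ} (h : e ∈ V8) : dot e e = 1 ∨ ∃ f g, IsDecomp e f g := by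
  obtain ⟨a, b⟩ := e
  obtain ⟨h1, h2, h3⟩ := h
  simp only [Set.mem_insert_iff, Set.mem_singleton_iff] at h1 h2
  rcases h1 with rfl | rfl | rfl <;> rcases h2 with rfl | rfl | rfl
  · exact Or.inr ⟨(-1, 0), (0, -1), by simp [IsDecomp, det, dot]⟩
  · left; simp [dot]
  · exact Or.inr ⟨(0, 1), (-1, 0), by simp [IsDecomp, det, dot]⟩
  · left; simp [dot]
  · simp at h3
  · left; simp [dot]
  · exact Or.inr ⟨(0, -1), (1, 0), by simp [IsDecomp, det, dot]⟩
  · left; simp [dot]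
  · exact Or.inr ⟨(1, 0), (0, 1), by simp [IsDecomp, det, dot]⟩

theorem TreeEdge.exists_decomp {a b : ℤ × ℤ} (h : TreeEdge a b) :
    (∃ f g, IsDecomp a f g) ∧ ∃ f g, IsDecomp b f g := by
  obtain ⟨f, g, hd, rfl | rfl⟩ := h
  · exact ⟨⟨f, g, hd⟩, _, _, hd.left⟩
  · exact ⟨⟨f, g, hd⟩, _, _, hd.right⟩

theorem TreeEdge.two_lt_dot_self {a b : ℤ × ℤ} (h : TreeEdge a b) : 2 < dot b b := by
  obtain ⟨f, g, hd, rfl | rfl⟩ := h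
  · have h1 := hd.left.dot_self_lt
    have h2 := hd.dot_self_lt
    have := dot_self_pos_of_det hd.2.1
    omega
  · have h1 := hd.right.dot_self_lt
    have h2 := hd.dot_self_lt
    have := dot_self_pos_of_det hd.2.1
    omega

/-- The parent is the longer summand in the unique decomposition of e. -/
theorem TreeEdge.parent_unique {a b e : ℤ × ℤ} (ha : TreeEdge a e) (hb : TreeEdge b e) :
    a = b := by
  obtain ⟨f, g, hd, he | he⟩ := ha <;> obtain ⟨f', g', hd', he' | he'⟩ := hb
  · exact ((he ▸ hd.left).unique (he' ▸ hd'.left)).2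
  · obtain ⟨rfl, rfl⟩ := (he ▸ hd.left).unique (he' ▸ hd'.right)
    have := hd.dot_self_lt
    have := hd'.dot_self_lt
    omega
  · obtain ⟨rfl, rfl⟩ := (he ▸ hd.right).unique (he' ▸ hd'.left)
    have := hd.dot_self_lt
    have := hd'.dot_self_lt
    omega
  · exact ((he ▸ hd.right).unique (he' ▸ hd'.right)).1

/-! ## Stencils are closed under taking parents -/

/-- Both properties propagate along a path in V starting from `V8`, whose elements have no parent. A
step towards a child adds one vertex to the ancestors, as parents are unique; a step towards a
parent only removes some. The second property replaces a Euclidean algorithm for primitive vectors.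
-/
theorem Hierarchy.ancestors_mem {V : Set (ℤ × ℤ)} (hV : Hierarchy V) {e : ℤ × ℤ} (he : e ∈ V) :
    (∀ a, Relation.ReflTransGen TreeEdge a e → a ∈ V) ∧
      (dot e e = 1 ∨ ∃ f g, IsDecomp e f g) := by
  obtain ⟨v, hv8, hv⟩ := hV ((treeGraph.induce V).connectedComponentMk ⟨e, he⟩)
  rw [SimpleGraph.ConnectedComponent.eq, SimpleGraph.reachable_iff_reflTransGen] at hv
  suffices ∀ w : V, Relation.ReflTransGen (treeGraph.induce V).Adj v w →
      (∀ a, Relation.ReflTransGen TreeEdge a w → a ∈ V) ∧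
        (dot (w : ℤ × ℤ) w = 1 ∨ ∃ f g, IsDecomp w f g) from this _ hv
  intro w hw
  induction hw with
  | refl =>
    refine ⟨fun a ha => ?_, V8_unit_or_decomp hv8⟩
    rcases ha.cases_tail with h | ⟨b, -, hb⟩
    · exact h ▸ v.2
    · have := hb.two_lt_dot_self
      rcases V8_dot_self hv8 with h | h <;> omega
  | @tail b c _ hbc ih =>
    have hadj : TreeEdge b c ∨ TreeEdge c b := by
      have : treeGraph.Adj b c := hbc
      exact ((SimpleGraph.fromRel_adj _ _ _).1 this).2
    rcases hadj with h | h
    · refine ⟨fun a ha => ?_, Or.inr h.exists_decomp.2⟩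
      rcases ha.cases_tail with h' | ⟨d, had, hdc⟩
      · exact h' ▸ c.2
      · rw [hdc.parent_unique h] at had
        exact ih.1 a had
    · exact ⟨fun a ha => ih.1 a (ha.tail h), Or.inr h.exists_decomp.1⟩

theorem Hierarchy.parent_mem {V : Set (ℤ × ℤ)} (hV : Hierarchy V) {e p : ℤ × ℤ} (he : e ∈ V)
    (hp : TreeEdge p e) : p ∈ V :=
  (hV.ancestors_mem he).1 p (Relation.ReflTransGen.single hp)

theorem innerVectors_neg {Ω : Set (ℝ × ℝ)} {x e : ℤ × ℤ} (h : e ∈ innerVectors Ω x) :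
    -e ∈ innerVectors Ω x := by
  obtain ⟨f, g, hd, he, hf, hg⟩ := h
  refine ⟨-f, -g, hd.neg, ?_, ?_, ?_⟩ <;>
    simp only [sub_neg_eq_add, ← sub_eq_add_neg] <;> tauto

theorem grid_finite {Ω : Set (ℝ × ℝ)} (h : Bornology.IsBounded Ω) : (grid Ω).Finite := by
  obtain ⟨C, hC⟩ := h.subset_closedBall 0
  refine Set.Finite.subset ((Set.finite_Icc (-⌈C⌉) ⌈C⌉).prod (Set.finite_Icc (-⌈C⌉) ⌈C⌉)) ?_
  intro z hz
  have := hC hz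
  rw [mem_closedBall_zero_iff, Prod.norm_def, max_le_iff] at this
  simp only [toPlane, Real.norm_eq_abs, abs_le] at this
  obtain ⟨⟨h1, h2⟩, h3, h4⟩ := this
  have hc := Int.le_ceil C
  refine ⟨⟨?_, ?_⟩, ?_, ?_⟩ <;> rify <;> linarith

theorem innerVectors_finite {Ω : Set (ℝ × ℝ)} (h : Bornology.IsBounded Ω) (x : ℤ × ℤ) :
    (innerVectors Ω x).Finite := by
  refine ((grid_finite h).image (fun z => z - x)).subset ?_
  rintro e ⟨f, g, -, he, -, -⟩
  exact ⟨x + e, he.1, by simp⟩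

/-! ## The pairs of vectors met by the adaptive algorithm -/

section Adaptive

variable {Ω : Set (ℝ × ℝ)} {V : grid Ω → Set (ℤ × ℤ)} {u : DiscreteMap Ω} {x : grid Ω}

/-- The two bases obtained from `(f, g)` when the refinement test succeeds. -/
def Refines (V : grid Ω → Set (ℤ × ℤ)) (u : DiscreteMap Ω) (x : grid Ω)
    (p q : (ℤ × ℤ) × (ℤ × ℤ)) : Prop :=
  RefinementTest V u x p.1 p.2 ∧ (q = (p.1, p.1 + p.2) ∨ q = (p.1 + p.2, p.2))

/-- The basis `(f, g)` is obtained from a direct orthonormal basis by successive refinements, and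
passes the refinement test itself. -/
def Accepted (V : grid Ω → Set (ℤ × ℤ)) (u : DiscreteMap Ω) (x : grid Ω)
    (f g : ℤ × ℤ) : Prop :=
  (∃ r : (ℤ × ℤ) × (ℤ × ℤ), det r.1 r.2 = 1 ∧ dot r.1 r.2 = 0 ∧
    Relation.ReflTransGen (Refines V u x) r (f, g)) ∧ RefinementTest V u x f g

theorem eq_of_det_one_of_dot_zero {f g : ℤ × ℤ} (h1 : det f g = 1) (h0 : dot f g = 0) :
    dot f f = 1 ∧ dot g g = 1 := by
  have h := det_sq_add_dot_sq f g
  rw [h1, h0] at h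
  obtain ⟨hf, hg⟩ := dot_self_pos_of_det h1
  constructor <;> nlinarith

theorem orthonormal_cases {f g : ℤ × ℤ} (h1 : det f g = 1) (h0 : dot f g = 0) :
    ((f, g) = ((1, 0), (0, 1)) ∨ (f, g) = ((0, 1), (-1, 0))) ∨
      ((-f, -g) = ((1, 0), (0, 1)) ∨ (-f, -g) = ((0, 1), (-1, 0))) := by
  obtain ⟨a, b⟩ := f
  obtain ⟨c, d⟩ := g
  have ⟨h, _⟩ := eq_of_det_one_of_dot_zero h1 h0
  simp only [dot, det] at h h1 h0
  have ha : -1 ≤ a ∧ a ≤ 1 := by constructor <;> nlinarith [mul_self_nonneg b]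
  have hb : -1 ≤ b ∧ b ≤ 1 := by constructor <;> nlinarith [mul_self_nonneg a]
  obtain ⟨ha1, ha2⟩ := ha
  obtain ⟨hb1, hb2⟩ := hb
  simp only [Prod.mk.injEq, Prod.neg_mk]
  interval_cases a <;> interval_cases b <;> omega

theorem RefinementTest.neg (hV : IsStencilFamily Ω V) {f g : ℤ × ℤ}
    (h : RefinementTest V u x f g) : RefinementTest V u x (-f) (-g) := by
  have e : -f + -g = -(f + g) := by abel
  unfold RefinementTest
  rw [e, secondDiff_neg, secondDiff_neg, secondDiff_neg]
  exact h.imp ((hV.isStencil x).2.2 _) (And.imp_left innerVectors_neg)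

theorem Refines.reflTransGen_neg (hV : IsStencilFamily Ω V) {p q : (ℤ × ℤ) × (ℤ × ℤ)}
    (h : Relation.ReflTransGen (Refines V u x) p q) :
    Relation.ReflTransGen (Refines V u x) (-p) (-q) := by
  refine h.lift (fun p => -p) ?_
  rintro ⟨f, g⟩ q ⟨h1, rfl | rfl⟩
  · exact ⟨h1.neg hV, Or.inl (by simp [add_comm])⟩
  · exact ⟨h1.neg hV, Or.inr (by simp [add_comm])⟩

theorem RefinementTest.mem_extend {f g : ℤ × ℤ} (h : RefinementTest V u x f g) :
    f + g ∈ extend V x := h.imp id And.left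

theorem extend_neg (hV : IsStencilFamily Ω V) {e : ℤ × ℤ} (h : e ∈ extend V x) :
    -e ∈ extend V x :=
  h.imp ((hV.isStencil x).2.2 _) innerVectors_neg

theorem refines_mem_extend {r p : (ℤ × ℤ) × (ℤ × ℤ)}
    (h : Relation.ReflTransGen (Refines V u x) r p)
    (hr : r.1 ∈ extend V x ∧ r.2 ∈ extend V x ∧ det r.1 r.2 = 1) :
    p.1 ∈ extend V x ∧ p.2 ∈ extend V x ∧ det p.1 p.2 = 1 := by
  induction h with
  | refl => exact hr
  | tail _ h ih =>
    obtain ⟨h1, rfl | rfl⟩ := h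
    · refine ⟨ih.1, h1.mem_extend, ?_⟩
      rw [← ih.2.2]; simp only [det, Prod.fst_add, Prod.snd_add]; ring
    · refine ⟨h1.mem_extend, ih.2.1, ?_⟩
      rw [← ih.2.2]; simp only [det, Prod.fst_add, Prod.snd_add]; ring

theorem Accepted.mem_extend (hV : IsStencilFamily Ω V) {f g : ℤ × ℤ} (h : Accepted V u x f g) :
    f ∈ extend V x ∧ g ∈ extend V x ∧ det f g = 1 := by
  obtain ⟨⟨r, h1, h0, hr⟩, -⟩ := h
  obtain ⟨hf, hg⟩ := eq_of_det_one_of_dot_zero h1 h0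
  exact refines_mem_extend hr
    ⟨Or.inl (hV.v8_subset x (mem_V8_of_dot_self_le (by omega) (by omega))),
      Or.inl (hV.v8_subset x (mem_V8_of_dot_self_le (by omega) (by omega))), h1⟩

theorem accepted_of_orthonormal (hV : IsStencilFamily Ω V) {f g : ℤ × ℤ} (h1 : det f g = 1)
    (h0 : dot f g = 0) : Accepted V u x f g := by
  refine ⟨⟨(f, g), h1, h0, .refl⟩, Or.inl (hV.v8_subset x (mem_V8_of_dot_self_le ?_ ?_))⟩ <;>
  · have := dot_add_self f g
    have := eq_of_det_one_of_dot_zero h1 h0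
    omega

/-- The algorithm explores the bases refining `(f, g)`, then moves on to the rest of the list,
having updated the current minimum. -/
theorem exists_iterate_step {N : ℤ} (hN : ∀ e ∈ extend V x, dot e e ≤ N) (f g : ℤ × ℤ)
    (h1 : det f g = 1) (h0 : 0 ≤ dot f g) :
    ∃ (n : ℕ) (m : WithTop ℝ),
      (∀ G b, (step V u x)^[n] ⟨f, g :: G, b⟩ = ⟨g, G, min b m⟩) ∧
      (∀ p, Relation.ReflTransGen (Refines V u x) (f, g) p → RefinementTest V u x p.1 p.2 →
        m ≤ (hDiff u x (p.1 + p.2) p.1 p.2 : ℝ)) ∧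
      (m = ⊤ ∨ ∃ p, Relation.ReflTransGen (Refines V u x) (f, g) p ∧
        RefinementTest V u x p.1 p.2 ∧ m = (hDiff u x (p.1 + p.2) p.1 p.2 : ℝ)) := by
  -- A successful test forces the squared norm of f + g to be at most N, so the measure is positive
  -- and decreases strictly for both children, even if they exceed the bound.
  induction hk : (N + 1 - dot (f + g) (f + g)).toNat using Nat.strong_induction_on
    generalizing f g with
  | _ k ih =>
  by_cases hR : RefinementTest V u x f g
  · have hd : IsDecomp (f + g) f g := ⟨rfl, h1, h0⟩
    have hle := hN _ hR.mem_extend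
    have hl := hd.left.dot_self_lt.2
    have hr := hd.right.dot_self_lt.1
    obtain ⟨n₁, m₁, hs₁, hb₁, ha₁⟩ := ih _ (by omega) f (f + g) hd.left.2.1 hd.left.2.2 rfl
    obtain ⟨n₂, m₂, hs₂, hb₂, ha₂⟩ := ih _ (by omega) (f + g) g hd.right.2.1 hd.right.2.2 rfl
    have rl : Refines V u x (f, g) (f, f + g) := ⟨hR, Or.inl rfl⟩
    have rr : Refines V u x (f, g) (f + g, g) := ⟨hR, Or.inr rfl⟩
    refine ⟨n₂ + (n₁ + 1), min (hDiff u x (f + g) f g : ℝ) (min m₁ m₂), ?_, ?_, ?_⟩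
    · intro G b
      rw [Function.iterate_add_apply, Function.iterate_add_apply, Function.iterate_one]
      have : step V u x ⟨f, g :: G, b⟩ =
          ⟨f, (f + g) :: g :: G, min b ((hDiff u x (f + g) f g : ℝ) : WithTop ℝ)⟩ := by
        simp [step, hR]
      rw [this, hs₁, hs₂, min_assoc, min_assoc]
    · intro p hp hpR
      rcases hp.cases_head with rfl | ⟨q, ⟨-, rfl | rfl⟩, hqp⟩
      · exact min_le_left _ _
      · exact (min_le_right _ _).trans ((min_le_left _ _).trans (hb₁ p hqp hpR))
      · exact (min_le_right _ _).trans ((min_le_right _ _).trans (hb₂ p hqp hpR))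
    · right
      -- Taking the minimum with a quantity that is infinite or attained preserves attainment.
      have key : ∀ m : WithTop ℝ,
          (m = ⊤ ∨ ∃ p, Relation.ReflTransGen (Refines V u x) (f, g) p ∧
            RefinementTest V u x p.1 p.2 ∧ m = (hDiff u x (p.1 + p.2) p.1 p.2 : ℝ)) →
          ∀ m' : WithTop ℝ, (∃ p, Relation.ReflTransGen (Refines V u x) (f, g) p ∧
            RefinementTest V u x p.1 p.2 ∧ m' = (hDiff u x (p.1 + p.2) p.1 p.2 : ℝ)) →
          (∃ p, Relation.ReflTransGen (Refines V u x) (f, g) p ∧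
            RefinementTest V u x p.1 p.2 ∧
              min m' m = (hDiff u x (p.1 + p.2) p.1 p.2 : ℝ)) := by
        rintro m (rfl | hm) m' hm'
        · simpa using hm'
        · rcases min_choice m' m with h | h <;> rw [h] <;> assumption
      rw [← min_assoc]
      refine key m₂ ?_ _ (key m₁ ?_ _ ⟨(f, g), .refl, hR, rfl⟩)
      · exact ha₂.imp id fun ⟨p, hp, h⟩ => ⟨p, hp.head rr, h⟩
      · exact ha₁.imp id fun ⟨p, hp, h⟩ => ⟨p, hp.head rl, h⟩
  · refine ⟨1, ⊤, ?_, ?_, Or.inl rfl⟩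
    · intro G b
      simp [step, hR]
    · intro p hp hpR
      rcases hp.cases_head with rfl | ⟨q, ⟨h, -⟩, -⟩
      · exact absurd hpR hR
      · exact absurd h hR

/-- The algorithm terminates, and returns the smallest value met at the accepted bases. -/
theorem exists_returns (hV : IsStencilFamily Ω V) (hΩ : Bornology.IsBounded Ω)
    (u : DiscreteMap Ω) (x : grid Ω) :
    ∃ d : ℝ, Returns V u x d ∧ (∀ f g, Accepted V u x f g → d ≤ hDiff u x (f + g) f g) ∧
      ∃ f g, Accepted V u x f g ∧ d = hDiff u x (f + g) f g := by
  have hfin : (extend V x).Finite := (hV.isStencil x).1.union (innerVectors_finite hΩ x)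
  obtain ⟨N, hN⟩ := (hfin.image fun e => dot e e).bddAbove
  have hN' : ∀ e ∈ extend V x, dot e e ≤ N := fun e he => hN ⟨e, he, rfl⟩
  obtain ⟨n₁, m₁, hs₁, hb₁, ha₁⟩ := exists_iterate_step (u := u) hN' (1, 0) (0, 1)
    (by simp [det]) (by simp [dot])
  obtain ⟨n₂, m₂, hs₂, hb₂, ha₂⟩ := exists_iterate_step (u := u) hN' (0, 1) (-1, 0)
    (by simp [det]) (by simp [dot])
  have hR₁ := accepted_of_orthonormal (u := u) (x := x) hV (f := (1, 0)) (g := (0, 1))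
    (by simp [det]) (by simp [dot])
  have hfinal : ∃ f g, Accepted V u x f g ∧ min m₁ m₂ = (hDiff u x (f + g) f g : ℝ) := by
    -- The initial basis is always accepted, because its sum lies in `V8`; hence the minimum is
    -- finite.
    have hm₁ : m₁ ≠ ⊤ := ne_top_of_le_ne_top WithTop.coe_ne_top (hb₁ _ .refl hR₁.2)
    have ha₁' := ha₁.resolve_left hm₁
    rcases min_choice m₁ m₂ with h | h
    · rw [h]
      obtain ⟨p, hp, hpR, hpm⟩ := ha₁'
      exact ⟨p.1, p.2, ⟨⟨_, by simp [det], by simp [dot], hp⟩, hpR⟩, hpm⟩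
    · rw [h]
      have hm₂ : m₂ ≠ ⊤ := ne_top_of_le_ne_top hm₁ (by rw [← h]; exact min_le_left _ _)
      obtain ⟨p, hp, hpR, hpm⟩ := ha₂.resolve_left hm₂
      exact ⟨p.1, p.2, ⟨⟨_, by simp [det], by simp [dot], hp⟩, hpR⟩, hpm⟩
  obtain ⟨f, g, hacc, hm⟩ := hfinal
  refine ⟨hDiff u x (f + g) f g, ⟨n₂ + n₁, ?_⟩, ?_, f, g, hacc, rfl⟩
  · rw [Function.iterate_add_apply, initState, hs₁, hs₂, ← hm]
    simp
  · have hpos : ∀ r p : (ℤ × ℤ) × (ℤ × ℤ), r = ((1, 0), (0, 1)) ∨ r = ((0, 1), (-1, 0)) →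
        Relation.ReflTransGen (Refines V u x) r p → RefinementTest V u x p.1 p.2 →
        hDiff u x (f + g) f g ≤ hDiff u x (p.1 + p.2) p.1 p.2 := by
      rintro r p (rfl | rfl) hp hpR <;> rw [← WithTop.coe_le_coe, ← hm]
      · exact (min_le_left _ _).trans (hb₁ p hp hpR)
      · exact (min_le_right _ _).trans (hb₂ p hp hpR)
    rintro f' g' ⟨⟨r, h1, h0, hr⟩, hR⟩
    -- The two runs cover two of the four direct orthonormal roots; the others are their opposites
    -- and give the same values.
    rcases orthonormal_cases h1 h0 with h | h
    · exact hpos r (f', g') h hr hR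
    · have := hpos (-r) (-f', -g') h (Refines.reflTransGen_neg hV hr) (hR.neg hV)
      have e : -f' + -g' = -(f' + g') := by abel
      dsimp only at this
      rwa [e, hDiff_neg] at this

/-! ### Pruned bases and discrete convexity -/

theorem Accepted.refine {p q : (ℤ × ℤ) × (ℤ × ℤ)} (h : Accepted V u x p.1 p.2)
    (hpq : q = (p.1, p.1 + p.2) ∨ q = (p.1 + p.2, p.2)) (hq : RefinementTest V u x q.1 q.2) :
    Accepted V u x q.1 q.2 := by
  obtain ⟨⟨r, h1, h0, hr⟩, hR⟩ := h
  exact ⟨⟨r, h1, h0, hr.tail ⟨hR, hpq⟩⟩, hq⟩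

/-- The basis `(f, g)` is in the range of the extended stencils, but is pruned. -/
def Pruned (V : grid Ω → Set (ℤ × ℤ)) (u : DiscreteMap Ω) (x : grid Ω) (f g : ℤ × ℤ) : Prop :=
  f + g ∉ V x ∧ f + g ∈ innerVectors Ω x ∧
    secondDiff u x f + secondDiff u x g ≤ secondDiff u x (f + g)

theorem IsDecomp.mem_grid_of_mem_innerVectors {y e f g : ℤ × ℤ} (h : IsDecomp e f g)
    (he : e ∈ innerVectors Ω y) :
    (y + e ∈ grid Ω ∧ y - e ∈ grid Ω) ∧ (y + f ∈ grid Ω ∧ y - f ∈ grid Ω) ∧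
      (y + g ∈ grid Ω ∧ y - g ∈ grid Ω) := by
  obtain ⟨f', g', h', H⟩ := he
  obtain ⟨rfl, rfl⟩ := h.unique h'
  exact H

theorem mem_extend_of_mem_grid (hV : IsStencilFamily Ω V) {e : ℤ × ℤ}
    (he : e ∈ primitiveVectors) (h : ↑x + e ∈ grid Ω ∧ ↑x - e ∈ grid Ω) : e ∈ extend V x := by
  by_cases hi : e ∈ innerVectors Ω x
  · exact Or.inr hi
  · exact Or.inl (hV.reachability x e ⟨he, hi⟩ h.1 h.2)

/-- `u` is convex at the grid points in the directions shorter than a given bound. -/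
def ConvexUpTo (u : DiscreteMap Ω) (N : ℤ) : Prop :=
  ∀ y ∈ grid Ω, ∀ e ∈ primitiveVectors, dot e e < N → y + e ∈ grid Ω → y - e ∈ grid Ω →
    0 ≤ secondDiff u y e

/-- Induction towards the parent basis, whose sum is the longer of f and g. If the parent is
accepted, (f, g) is reached and the test decides. If it is pruned, (Hierarchy) excludes f + g from
V, and convexity at x ± the parent's sum, in the direction of the shorter vector, transfers the
pruning inequality. -/
theorem accepted_or_pruned (hV : IsStencilFamily Ω V) {N : ℤ} (hu : ConvexUpTo u N)
    (f g : ℤ × ℤ) (h1 : det f g = 1) (h0 : 0 ≤ dot f g) (he : f + g ∈ extend V x)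
    (hle : dot (f + g) (f + g) ≤ N) : Accepted V u x f g ∨ Pruned V u x f g := by
  induction hk : (dot (f + g) (f + g)).toNat using Nat.strong_induction_on
    generalizing f g with
  | _ k ih =>
  have hd : IsDecomp (f + g) f g := ⟨rfl, h1, h0⟩
  have hlt := hd.dot_self_lt
  have hprim := mem_primitiveVectors_of_det h1
  have done : (RefinementTest V u x f g → Accepted V u x f g) →
      Accepted V u x f g ∨ Pruned V u x f g := by
    intro h
    by_cases hR : RefinementTest V u x f g
    · exact Or.inl (h hR)
    · right
      simp only [RefinementTest, not_or, not_and, not_lt] at hR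
      have := he.resolve_left hR.1
      exact ⟨hR.1, this, hR.2 this⟩
  -- (Hierarchy) handles the case f + g ∈ V, and (Reachability) the case of an inner vector.
  have parent : ∀ p, IsDecomp (f + g) f g → TreeEdge p (f + g) → (p = f ∨ p = g) →
      p ∈ extend V x := by
    intro p hd hp hpfg
    rcases he with he | he
    · exact Or.inl ((hV.hierarchy x).parent_mem he hp)
    · have := hd.mem_grid_of_mem_innerVectors he
      rcases hpfg with rfl | rfl
      · exact mem_extend_of_mem_grid hV hprim.1 this.2.1
      · exact mem_extend_of_mem_grid hV hprim.2 this.2.2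
  rcases hd.cases_parent with h | h | h
  · exact Or.inl (accepted_of_orthonormal hV h1 h)
  · have hedge : TreeEdge f (f + g) := ⟨_, _, h, Or.inr rfl⟩
    have hsum : f - g + g = f := sub_add_cancel f g
    rcases ih _ (by rw [hsum]; have := dot_self_nonneg f; omega) (f - g) g h.2.1 h.2.2
      (by rw [hsum]; exact parent f hd hedge (Or.inl rfl)) (by rw [hsum]; omega) rfl with ha | hp
    · exact done fun hR => Accepted.refine (p := (f - g, g)) (q := (f, g)) ha
        (Or.inr (by simp)) hR
    · right
      obtain ⟨hp1, hp2, hp3⟩ := hp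
      rw [hsum] at hp1 hp2 hp3
      have heV : f + g ∉ V x := fun h => hp1 ((hV.hierarchy x).parent_mem h hedge)
      have heI := he.resolve_left heV
      obtain ⟨G1, G2, G3⟩ := hd.mem_grid_of_mem_innerVectors heI
      obtain ⟨-, G4, -⟩ := h.mem_grid_of_mem_innerVectors hp2
      refine ⟨heV, heI, secondDiff_add_le_of_convex u x hsum.symm G4 G3 G2 G1 hp3 ?_ ?_⟩
      · refine hu _ G2.1 g hprim.2 (by omega) ?_ ?_
        · rw [add_assoc]; exact G1.1
        · rw [add_sub_assoc]; exact G4.1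
      · refine hu _ G2.2 g hprim.2 (by omega) ?_ ?_
        · rw [sub_add]; exact G4.2
        · rw [sub_sub]; exact G1.2
  · have hedge : TreeEdge g (f + g) := ⟨_, _, h, Or.inl rfl⟩
    have hsum : f + (g - f) = g := add_sub_cancel f g
    rcases ih _ (by rw [hsum]; have := dot_self_nonneg g; omega) f (g - f) h.2.1 h.2.2
      (by rw [hsum]; exact parent g hd hedge (Or.inr rfl)) (by rw [hsum]; omega) rfl with ha | hp
    · exact done fun hR => Accepted.refine (p := (f, g - f)) (q := (f, g)) ha
        (Or.inl (by simp)) hR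
    · right
      obtain ⟨hp1, hp2, hp3⟩ := hp
      rw [hsum] at hp1 hp2 hp3
      have heV : f + g ∉ V x := fun h => hp1 ((hV.hierarchy x).parent_mem h hedge)
      have heI := he.resolve_left heV
      obtain ⟨G1, G2, G3⟩ := hd.mem_grid_of_mem_innerVectors heI
      obtain ⟨-, -, G4⟩ := h.mem_grid_of_mem_innerVectors hp2
      refine ⟨heV, heI, ?_⟩
      rw [add_comm f g] at G1 ⊢
      rw [add_comm]
      refine secondDiff_add_le_of_convex u x (sub_add_cancel g f).symm G4 G2 G3 G1
        (by linarith) ?_ ?_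
      · refine hu _ G3.1 f hprim.1 (by omega) ?_ ?_
        · rw [add_assoc]; exact G1.1
        · rw [add_sub_assoc]; exact G4.1
      · refine hu _ G3.2 f hprim.1 (by omega) ?_ ?_
        · rw [sub_add]; exact G4.2
        · rw [sub_sub]; exact G1.2

/-- If the adaptive operator is positive, then `u` is convex at the grid points. -/
theorem convexUpTo_of_pos (hV : IsStencilFamily Ω V)
    (hpos : ∀ (y : grid Ω) (f g : ℤ × ℤ), Accepted V u y f g → 0 < hDiff u y (f + g) f g)
    (n : ℕ) : ConvexUpTo u n := by
  induction n with
  | zero => intro y _ e _ hlt; exact absurd hlt (by simpa using dot_self_nonneg e)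
  | succ n ih =>
    intro y hy e hprim hlt hp hm
    have hmem := mem_extend_of_mem_grid (x := ⟨y, hy⟩) hV hprim ⟨hp, hm⟩
    have hcases : dot e e = 1 ∨ ∃ f g, IsDecomp e f g := by
      rcases hmem with h | ⟨f, g, h, -⟩
      · exact ((hV.hierarchy _).ancestors_mem h).2
      · exact Or.inr ⟨f, g, h⟩
    rcases hcases with h | ⟨f, g, hd⟩
    -- A unit vector is completed by its quarter turn into an orthonormal basis, which is always
    -- accepted.
    · have h1 : det e (-e.2, e.1) = 1 := by rw [← h]; simp [det, dot]
      have h0 : dot e (-e.2, e.1) = 0 := by simp [dot]; ring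
      exact (secondDiff_pos_of_hDiff_pos u y
        (hpos ⟨y, hy⟩ _ _ (accepted_of_orthonormal hV h1 h0))).2.1.le
    · have hlt' := hd.dot_self_lt
      obtain ⟨hf, hg⟩ := mem_primitiveVectors_of_det hd.2.1
      push_cast at hlt
      obtain ⟨rfl, h1, h0⟩ := id hd
      -- Convexity strictly below n suffices for a sum of squared norm at most n, since f and g are
      -- strictly shorter.
      rcases accepted_or_pruned (x := ⟨y, hy⟩) hV ih f g h1 h0 hmem (by omega) with h | h
      · exact (secondDiff_pos_of_hDiff_pos u y (hpos ⟨y, hy⟩ _ _ h)).1.le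
      · obtain ⟨-, G2, G3⟩ := hd.mem_grid_of_mem_innerVectors h.2.1
        exact (add_nonneg (ih y hy f hf (by omega) G2.1 G2.2)
          (ih y hy g hg (by omega) G3.1 G3.2)).trans h.2.2

/-- A pruned basis has a value at least that of its parent, so induction on length leads back to an
accepted basis. -/
theorem le_hDiff_of_mem_extend (hV : IsStencilFamily Ω V) {d : ℝ} (hu : ∀ n : ℕ, ConvexUpTo u n)
    (hd : ∀ f g, Accepted V u x f g → d ≤ hDiff u x (f + g) f g) (f g : ℤ × ℤ)
    (h1 : det f g = 1) (h0 : 0 ≤ dot f g) (he : f + g ∈ extend V x) :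
    d ≤ hDiff u x (f + g) f g := by
  induction hk : (dot (f + g) (f + g)).toNat using Nat.strong_induction_on
    generalizing f g with
  | _ k ih =>
  have hdec : IsDecomp (f + g) f g := ⟨rfl, h1, h0⟩
  have hlt := hdec.dot_self_lt
  obtain ⟨hf, hg⟩ := mem_primitiveVectors_of_det h1
  have hle := Int.self_le_toNat (dot (f + g) (f + g))
  rcases accepted_or_pruned hV (hu _) f g h1 h0 he hle with h | h
  · exact hd f g h
  obtain ⟨-, G2, G3⟩ := hdec.mem_grid_of_mem_innerVectors h.2.1
  have nf := hu _ x x.2 f hf (hlt.1.trans_le hle) G2.1 G2.2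
  have ng := hu _ x x.2 g hg (hlt.2.trans_le hle) G3.1 G3.2
  have mf := mem_extend_of_mem_grid hV hf G2
  have mg := mem_extend_of_mem_grid hV hg G3
  rcases hdec.cases_parent with hc | hc | hc
  · exact hd f g (accepted_of_orthonormal hV h1 hc)
  · have hsum : f - g + g = f := sub_add_cancel f g
    have := ih _ (by rw [hsum]; have := dot_self_nonneg f; omega) (f - g) g hc.2.1 hc.2.2
      (by rwa [hsum]) rfl
    rw [hsum, hDiff_rotate, hDiff_swap] at this
    exact this.trans (hDiff_le_hDiff_of_add_le u x nf ng h.2.2)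
  · have hsum : f + (g - f) = g := add_sub_cancel f g
    have := ih _ (by rw [hsum]; have := dot_self_nonneg g; omega) f (g - f) hc.2.1 hc.2.2
      (by rwa [hsum]) rfl
    rw [hsum, hDiff_rotate, hDiff_rotate, hDiff_swap] at this
    exact this.trans (hDiff_le_hDiff_of_add_le u x nf ng h.2.2)

/-! ### From superbases to direct acute bases -/

theorem IsSuperbase.rotate {e f g : ℤ × ℤ} (h : IsSuperbase e f g) : IsSuperbase f g e := by
  obtain ⟨h1, h2⟩ := h
  refine ⟨by rw [← h1]; abel, ?_⟩
  have he : e = -f - g := by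
    have : e + f + g - f - g = -f - g := by rw [h1]; abel
    rw [← this]; abel
  have : det g e = det f g := by
    rw [he]; simp only [det, Prod.fst_sub, Prod.snd_sub, Prod.fst_neg, Prod.snd_neg]; ring
  rw [IsBasis, this]; exact h2

theorem IsSuperbase.exists_acute {e f g : ℤ × ℤ} (h : IsSuperbase e f g) :
    0 ≤ dot f g ∨ 0 ≤ dot g e ∨ 0 ≤ dot e f := by
  by_contra! hcon
  obtain ⟨h1, h2, h3⟩ := hcon
  obtain ⟨hs, hb⟩ := h
  have he : e = -f - g := by
    have : e + f + g - f - g = -f - g := by rw [hs]; abel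
    rw [← this]; abel
  have hsq := det_sq_add_dot_sq f g
  rw [← sq_abs (det f g), hb] at hsq
  have e1 : dot g e = -dot f g - dot g g := by rw [he]; simp [dot]; ring
  have e2 : dot e f = -dot f g - dot f f := by rw [he]; simp [dot]; ring
  -- If all three products were negative, |f|² and |g|² would be at least 1 - ⟨f, g⟩, contradicting
  -- |f|²|g|² = 1 + ⟨f, g⟩².
  have : (1 - dot f g) * (1 - dot f g) ≤ dot f f * dot g g :=
    mul_le_mul (by omega) (by omega) (by omega) (by omega)
  nlinarith

theorem le_hDiff_of_isSuperbase (hV : IsStencilFamily Ω V) {d : ℝ}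
    (hd : ∀ f g, det f g = 1 → 0 ≤ dot f g → f + g ∈ extend V x → d ≤ hDiff u x (f + g) f g)
    {e f g : ℤ × ℤ} (he : e ∈ extend V x) (hf : f ∈ extend V x) (hg : g ∈ extend V x)
    (h : IsSuperbase e f g) : d ≤ hDiff u x e f g := by
  have key : ∀ e f g : ℤ × ℤ, e ∈ extend V x → IsSuperbase e f g → 0 ≤ dot f g →
      d ≤ hDiff u x e f g := by
    intro e f g he h h0
    have hfg : f + g = -e := by
      rw [← add_zero (-e), ← h.1]; abel
    rcases (abs_eq zero_le_one).1 h.2 with h1 | h1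
    · have := hd f g h1 h0 (hfg ▸ extend_neg hV he)
      rwa [hfg, hDiff_neg_left] at this
    · have := hd g f (by simp only [det] at h1 ⊢; linarith)
        (by simp only [dot] at h0 ⊢; linarith) (by rw [add_comm, hfg]; exact extend_neg hV he)
      rwa [add_comm, hfg, hDiff_neg_left, hDiff_swap] at this
  rcases h.exists_acute with h0 | h0 | h0
  · exact key e f g he h h0
  · rw [hDiff_rotate]; exact key f g e hf h.rotate h0
  · rw [hDiff_rotate, hDiff_rotate]; exact key g e f hg h.rotate.rotate h0

end Adaptive

end MALBR

/-- Both operators are well defined (the algorithm terminates at every point of `X`, the minimum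
over superbases is attained), the extended-stencil operator is at most the adaptive one, and they
coincide on `X` as soon as one of them is positive on `X`. -/
theorem theorem3 (Ω : Set (ℝ × ℝ)) (hΩ_convex : Convex ℝ Ω) (hΩ_open : IsOpen Ω)
    (hΩ_bounded : Bornology.IsBounded Ω)
    (V : MALBR.grid Ω → Set (ℤ × ℤ)) (hV : MALBR.IsStencilFamily Ω V)
    (u : MALBR.DiscreteMap Ω) :
    ∃ Dadapt Dext : MALBR.grid Ω → ℝ,
      MALBR.IsAdaptiveOperator V u Dadapt ∧
      MALBR.IsLBROperator (MALBR.extend V) u Dext ∧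
      (∀ x, Dext x ≤ Dadapt x) ∧
      ((∀ x, 0 < Dadapt x) ∨ (∀ x, 0 < Dext x) → ∀ x, Dadapt x = Dext x) := by
  choose Dadapt hret hle hatt using MALBR.exists_returns hV hΩ_bounded u
  have hset : ∀ x : MALBR.grid Ω,
      {r : ℝ | ∃ e ∈ MALBR.extend V x, ∃ f ∈ MALBR.extend V x, ∃ g ∈ MALBR.extend V x,
        MALBR.IsSuperbase e f g ∧ r = MALBR.hDiff u x e f g}.Finite := by
    intro x
    have hfin : (MALBR.extend V x).Finite :=
      (hV.isStencil x).1.union (MALBR.innerVectors_finite hΩ_bounded x)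
    refine ((hfin.prod (hfin.prod hfin)).image
      fun t => MALBR.hDiff u x t.1 t.2.1 t.2.2).subset ?_
    rintro r ⟨e, he, f, hf, g, hg, -, rfl⟩
    exact ⟨(e, f, g), ⟨he, hf, hg⟩, rfl⟩
  have hmem : ∀ x : MALBR.grid Ω, Dadapt x ∈
      {r : ℝ | ∃ e ∈ MALBR.extend V x, ∃ f ∈ MALBR.extend V x, ∃ g ∈ MALBR.extend V x,
        MALBR.IsSuperbase e f g ∧ r = MALBR.hDiff u x e f g} := by
    intro x
    obtain ⟨f, g, hacc, hd⟩ := hatt x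
    obtain ⟨hf, hg, h1⟩ := hacc.mem_extend hV
    refine ⟨-(f + g), MALBR.extend_neg hV hacc.2.mem_extend, f, hf, g, hg, ⟨by abel, ?_⟩, ?_⟩
    · rw [MALBR.IsBasis, h1, abs_one]
    · rw [hd, MALBR.hDiff_neg_left]
  choose Dext hext using fun x => (hset x).exists_minimal ⟨_, hmem x⟩
  have hleast : MALBR.IsLBROperator (MALBR.extend V) u Dext := fun x =>
    ⟨(hext x).prop, fun r hr => (le_total (Dext x) r).elim id fun h => (hext x).le_of_le hr h⟩
  have hDle : ∀ x, Dext x ≤ Dadapt x := fun x => (hleast x).2 (hmem x)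
  refine ⟨Dadapt, Dext, hret, hleast, hDle, fun hpos x => le_antisymm ?_ (hDle x)⟩
  have hpos' : ∀ y, 0 < Dadapt y :=
    hpos.elim id fun h y => (h y).trans_le (hDle y)
  have hconv := MALBR.convexUpTo_of_pos hV fun y f g h => (hpos' y).trans_le (hle y f g h)
  obtain ⟨e, he, f, hf, g, hg, hs, hd⟩ := (hleast x).1
  rw [hd]
  exact MALBR.le_hDiff_of_isSuperbase hV
    (fun f g h1 h0 h => MALBR.le_hDiff_of_mem_extend hV hconv (hle x) f g h1 h0 h) he hf hg hs
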